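/- For a finite graph $G$, let $i(G)$ denote the number of independent sets of $G$ (the empty set included). Let $G$ be a triangle-free graph with $n\ge 1$ vertices and average degree $t$. Then $i(G)\ge 2^{t}$, and if $t\ge 1$, then \[ i(G) \ \ge\ \max\Big\{ \exp\Big( \big(1-n^{-1/12}\big)\,\frac12\,\frac{n}{t}\,\ln t\,\Big(\frac12 \ln t-1\Big)\Big),\ 2^{t}\Big\}. \] Consequently, there is a function $\varepsilon:\mathbb{N}\to\mathbb{R}$ with $\varepsilon(n)\to 0$ as $n\to\infty$ such that every triangle-free graph $H$ on $n$ vertices satisfies \[ i(H)\ \ge\ \exp\Big( (1-\varepsilon(n))\,\frac{\sqrt{n\ln 2}\,\ln n}{4}\Big). \] -/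

import Mathlib

noncomputable section

open Classical in
/-- The number of independent sets of a finite graph (the empty set is counted). -/
def SimpleGraph.numIndepSets {V : Type*} [Fintype V] (G : SimpleGraph V) : ℕ :=
  (Finset.univ.filter fun s : Finset V => G.IsIndepSet (s : Set V)).card

open Classical in
/-- The average degree of a finite graph. -/
def SimpleGraph.avgDegree {V : Type*} [Fintype V] (G : SimpleGraph V) : ℝ :=
  (∑ v, (G.degree v : ℝ)) / (Fintype.card V : ℝ)

end

/-! ### Shearer's function: differential equation, convexity, logarithmic lower bound. -/

section ShearerFunction

open intervalIntegral

/-! Keep each vertex with probability `p`. An independent set `I` survives with probability `p ^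
|I|`, so `i(G)` is the expectation over samples `W` of the sum of `p ^ (-|I|)` over independent `I ⊆
W`. One large `I` in each sample suffices for a lower bound.

Such an `I` comes from Shearer's theorem, replaced by a tangent at a fixed point `a`
(`CliqueFree.exists_isIndepSet_subset`). The bound is then linear in the vertex count and degree sum
of `W`, so its mean is explicit and Jensen for `exp` finishes (`CliqueFree.exp_le_numIndepSets`). No
concentration is needed, and the factor `1 - n^(-1/12)` is pure slack.

The bound `2 ^ t` counts subsets of one neighbourhood. For the asymptotic form, the first bound
serves average degrees up to `balancedDegree n`, the second those above. -/

/-- Shearer's function `(a log a - a + 1) / (a - 1) ^ 2`, in integral form. -/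
noncomputable def shearerFun (a : ℝ) : ℝ :=
  ∫ x in (0 : ℝ)..1, (1 - x) / (1 + (a - 1) * x)

/-- The negative of the derivative of `shearerFun`. -/
noncomputable def shearerSlope (a : ℝ) : ℝ :=
  ∫ x in (0 : ℝ)..1, x * (1 - x) / (1 + (a - 1) * x) ^ 2

theorem shearerDenom_pos {a x : ℝ} (ha : 0 < a) (hx : x ∈ Set.Icc (0 : ℝ) 1) :
    0 < 1 + (a - 1) * x := by
  obtain ⟨h0, h1⟩ := hx
  rcases h1.lt_or_eq with h | rfl
  · nlinarith [mul_nonneg ha.le h0]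
  · linarith

theorem intervalIntegrable_shearerFun {a : ℝ} (ha : 0 < a) :
    IntervalIntegrable (fun x : ℝ => (1 - x) / (1 + (a - 1) * x)) MeasureTheory.volume 0 1 := by
  apply ContinuousOn.intervalIntegrable
  rw [Set.uIcc_of_le zero_le_one]
  exact ContinuousOn.div (by fun_prop) (by fun_prop) fun x hx => (shearerDenom_pos ha hx).ne'

theorem intervalIntegrable_shearerSlope {a : ℝ} (ha : 0 < a) :
    IntervalIntegrable (fun x : ℝ => x * (1 - x) / (1 + (a - 1) * x) ^ 2)
      MeasureTheory.volume 0 1 := by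
  apply ContinuousOn.intervalIntegrable
  rw [Set.uIcc_of_le zero_le_one]
  exact ContinuousOn.div (by fun_prop) (by fun_prop)
    fun x hx => pow_ne_zero 2 (shearerDenom_pos ha hx).ne'

theorem shearerSlope_nonneg {a : ℝ} : 0 ≤ shearerSlope a := by
  apply integral_nonneg zero_le_one
  rintro x ⟨h0, h1⟩
  have : 0 ≤ 1 - x := by linarith
  positivity

/-- Shearer's differential equation. -/
theorem shearerFun_ode {a : ℝ} (ha : 0 < a) :
    1 - (a + 1) * shearerFun a + (a ^ 2 - a) * shearerSlope a = 0 := by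
  have hF := intervalIntegrable_shearerFun ha
  have hD := intervalIntegrable_shearerSlope ha
  have key : ∫ x in (0 : ℝ)..1, ((1 - (a + 1) * ((1 - x) / (1 + (a - 1) * x)))
      + (a ^ 2 - a) * (x * (1 - x) / (1 + (a - 1) * x) ^ 2))
      = (-a * (1 * (1 - 1)) / (1 + (a - 1) * 1)) - (-a * (0 * (1 - 0)) / (1 + (a - 1) * 0)) := by
    -- The left side of the equation integrates an exact derivative whose primitive vanishes at `0`
    -- and `1`.
    apply integral_eq_sub_of_hasDerivAt (f := fun x => -a * (x * (1 - x)) / (1 + (a - 1) * x))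
    · intro x hx
      rw [Set.uIcc_of_le zero_le_one] at hx
      have hq := (shearerDenom_pos ha hx).ne'
      have h1 : HasDerivAt (fun x : ℝ => -a * (x * (1 - x))) (-a * (1 * (1 - x) + x * (-1))) x :=
        ((hasDerivAt_id x).mul ((hasDerivAt_id x).const_sub 1)).const_mul (-a)
      have h2 : HasDerivAt (fun x : ℝ => 1 + (a - 1) * x) ((a - 1) * 1) x :=
        ((hasDerivAt_id x).const_mul (a - 1)).const_add 1
      refine (h1.div h2 hq).congr_deriv ?_
      generalize hy : 1 + (a - 1) * x = y at hq ⊢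
      field_simp
      rw [← hy]
      ring
    · exact (intervalIntegrable_const.sub (hF.const_mul _)).add (hD.const_mul _)
  rw [integral_add (intervalIntegrable_const.sub (hF.const_mul _)) (hD.const_mul _),
    integral_sub intervalIntegrable_const (hF.const_mul _), integral_const_mul,
    integral_const_mul] at key
  simpa [shearerFun, shearerSlope] using key

/-- The graph of Shearer's function lies above its tangents. -/
theorem shearerFun_tangent_le {a b : ℝ} (ha : 0 < a) (hb : 0 < b) :
    shearerFun a + a * shearerSlope a - b * shearerSlope a ≤ shearerFun b := by
  have hF := intervalIntegrable_shearerFun ha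
  have hD := intervalIntegrable_shearerSlope ha
  have h : shearerFun a + a * shearerSlope a - b * shearerSlope a =
      ∫ x in (0 : ℝ)..1, ((1 - x) / (1 + (a - 1) * x)
        + (a - b) * (x * (1 - x) / (1 + (a - 1) * x) ^ 2)) := by
    rw [integral_add hF (hD.const_mul _), integral_const_mul, shearerFun, shearerSlope]
    ring
  rw [h]
  apply integral_mono_on zero_le_one (hF.add (hD.const_mul _)) (intervalIntegrable_shearerFun hb)
  intro x hx
  have hp := shearerDenom_pos ha hx
  have hq := shearerDenom_pos hb hx
  have h1 : 0 ≤ 1 - x := by linarith [hx.2]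
  rw [← sub_nonneg]
  have : (1 - x) / (1 + (b - 1) * x) - ((1 - x) / (1 + (a - 1) * x)
        + (a - b) * (x * (1 - x) / (1 + (a - 1) * x) ^ 2))
      = (1 - x) * ((a - b) * x) ^ 2 / ((1 + (b - 1) * x) * (1 + (a - 1) * x) ^ 2) := by
    generalize hy : 1 + (a - 1) * x = y at hp ⊢
    generalize hz : 1 + (b - 1) * x = z at hq ⊢
    field_simp
    rw [← hy, ← hz]
    ring
  rw [this]
  positivity

/-- The combined integrand is `1` minus a square. This settles the edgeless case of the induction.
-/
theorem shearerFun_add_mul_slope_le_one {a : ℝ} (ha : 0 < a) :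
    shearerFun a + a * shearerSlope a ≤ 1 := by
  have hF := intervalIntegrable_shearerFun ha
  have hD := intervalIntegrable_shearerSlope ha
  have h : shearerFun a + a * shearerSlope a =
      ∫ x in (0 : ℝ)..1, ((1 - x) / (1 + (a - 1) * x)
        + a * (x * (1 - x) / (1 + (a - 1) * x) ^ 2)) := by
    rw [integral_add hF (hD.const_mul _), integral_const_mul, shearerFun, shearerSlope]
  have h1 : ∫ _ in (0 : ℝ)..1, (1 : ℝ) = 1 := by simp
  rw [h]
  refine (integral_mono_on zero_le_one (hF.add (hD.const_mul _))
    (intervalIntegrable_const (c := (1 : ℝ))) ?_).trans_eq h1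
  intro x hx
  have hp := shearerDenom_pos ha hx
  rw [← sub_nonneg]
  have : 1 - ((1 - x) / (1 + (a - 1) * x) + a * (x * (1 - x) / (1 + (a - 1) * x) ^ 2))
      = (a * x) ^ 2 / (1 + (a - 1) * x) ^ 2 := by
    generalize hy : 1 + (a - 1) * x = y at hp ⊢
    field_simp
    rw [← hy]
    ring
  rw [this]
  positivity

theorem log_sub_one_div_le_shearerFun {a : ℝ} (ha : 1 ≤ a) :
    (Real.log a - 1) / a ≤ shearerFun a := by
  have ha0 : 0 < a := by linarith
  have hpos : ∀ x ∈ Set.Icc (0 : ℝ) 1, 0 < 1 + a * x := fun x hx => by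
    have := mul_nonneg ha0.le hx.1
    linarith
  have hI : IntervalIntegrable (fun x : ℝ => 1 / (1 + a * x)) MeasureTheory.volume 0 1 := by
    apply ContinuousOn.intervalIntegrable
    rw [Set.uIcc_of_le zero_le_one]
    exact ContinuousOn.div (by fun_prop) (by fun_prop) fun x hx => (hpos x hx).ne'
  have key : ∫ x in (0 : ℝ)..1, 1 / (1 + a * x) =
      Real.log (1 + a * 1) / a - Real.log (1 + a * 0) / a := by
    apply integral_eq_sub_of_hasDerivAt (f := fun x => Real.log (1 + a * x) / a) _ hI
    intro x hx
    rw [Set.uIcc_of_le zero_le_one] at hx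
    have hq := (hpos x hx).ne'
    have h2 : HasDerivAt (fun x : ℝ => 1 + a * x) (a * 1) x :=
      ((hasDerivAt_id x).const_mul a).const_add 1
    refine ((h2.log hq).div_const a).congr_deriv ?_
    rw [mul_one, div_right_comm, div_self ha0.ne']
  have hlog : Real.log a ≤ Real.log (1 + a) := Real.log_le_log ha0 (by linarith)
  calc (Real.log a - 1) / a ≤ Real.log (1 + a) / a - 1 / a := by
        rw [← sub_div]; gcongr
    _ = ∫ x in (0 : ℝ)..1, (1 / (1 + a * x) - 1 / a) := by
        rw [integral_sub hI intervalIntegrable_const, key]; simp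
    _ ≤ shearerFun a := by
        apply integral_mono_on zero_le_one (hI.sub intervalIntegrable_const)
          (intervalIntegrable_shearerFun ha0)
        intro x hx
        have hp := shearerDenom_pos ha0 hx
        have h1 : 1 / (1 + a * x) ≤ 1 / (1 + (a - 1) * x) :=
          one_div_le_one_div_of_le hp (by nlinarith [hx.1])
        have h2 : x / (1 + (a - 1) * x) ≤ 1 / a := by
          rw [div_le_div_iff₀ hp ha0]; nlinarith [hx.2]
        rw [sub_div]
        linarith

end ShearerFunction

/-! ### Shearer's theorem for induced subgraphs. -/

namespace SimpleGraph

variable {V : Type*}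

open Classical in
/-- The degree of `v` into the vertex set `W`. -/
noncomputable def degreeIn (G : SimpleGraph V) (W : Finset V) (v : V) : ℝ :=
  ∑ u ∈ W, if G.Adj v u then 1 else 0

theorem CliqueFree.not_adj_of_common {G : SimpleGraph V} (hG : G.CliqueFree 3) {v x y : V}
    (hx : G.Adj v x) (hy : G.Adj v y) : ¬ G.Adj x y := by
  classical
  intro h
  exact hG {v, x, y} (is3Clique_triple_iff.mpr ⟨hx, hy, h⟩)

open Classical in
/-- Deleting a closed neighbourhood from a triangle-free graph. -/
theorem sum_degreeIn_sdiff_le {G : SimpleGraph V} (hG : G.CliqueFree 3) (W : Finset V) (v : V) :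
    ∑ x ∈ W.filter (fun u => u ≠ v ∧ ¬ G.Adj v u),
        G.degreeIn (W.filter fun u => u ≠ v ∧ ¬ G.Adj v u) x
      + 2 * ∑ u ∈ W, (if G.Adj v u then 1 else 0) * G.degreeIn W u
      ≤ ∑ x ∈ W, G.degreeIn W x := by
  have h1 : ∑ x ∈ W.filter (fun u => u ≠ v ∧ ¬ G.Adj v u),
        G.degreeIn (W.filter fun u => u ≠ v ∧ ¬ G.Adj v u) x =
      ∑ x ∈ W, ∑ y ∈ W, if ((x ≠ v ∧ ¬ G.Adj v x) ∧ (y ≠ v ∧ ¬ G.Adj v y)) ∧ G.Adj x y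
        then (1 : ℝ) else 0 := by
    rw [Finset.sum_filter]
    refine Finset.sum_congr rfl fun x _ => ?_
    rw [degreeIn, Finset.sum_filter]
    split_ifs with h
    · refine Finset.sum_congr rfl fun y _ => ?_
      by_cases h' : y ≠ v ∧ ¬ G.Adj v y <;> simp [h, h']
    · exact (Finset.sum_eq_zero fun y _ => if_neg fun h' => h h'.1.1).symm
  have h2 : ∑ u ∈ W, (if G.Adj v u then (1 : ℝ) else 0) * G.degreeIn W u =
      ∑ x ∈ W, ∑ y ∈ W, if G.Adj v x ∧ G.Adj x y then (1 : ℝ) else 0 := by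
    refine Finset.sum_congr rfl fun x _ => ?_
    rw [degreeIn, Finset.mul_sum]
    refine Finset.sum_congr rfl fun y _ => ?_
    by_cases h : G.Adj v x <;> simp [h]
  have h3 : ∑ u ∈ W, (if G.Adj v u then (1 : ℝ) else 0) * G.degreeIn W u =
      ∑ x ∈ W, ∑ y ∈ W, if G.Adj v y ∧ G.Adj x y then (1 : ℝ) else 0 := by
    rw [h2, Finset.sum_comm]
    simp only [G.adj_comm]
  rw [two_mul, h1]
  nth_rewrite 1 [h2]
  rw [h3, ← Finset.sum_add_distrib, ← Finset.sum_add_distrib]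
  refine Finset.sum_le_sum fun x _ => ?_
  rw [degreeIn, ← Finset.sum_add_distrib, ← Finset.sum_add_distrib]
  refine Finset.sum_le_sum fun y _ => ?_
  by_cases hxy : G.Adj x y
  · by_cases hx : G.Adj v x
    · have hy : ¬ G.Adj v y := fun hy => hG.not_adj_of_common hx hy hxy
      simp [hxy, hx, hy]
    · by_cases hy : G.Adj v y
      · simp [hxy, hx, hy]
      · simp only [hxy, hx, hy, not_false_eq_true, and_true, if_false, add_zero, if_true]
        split_ifs <;> norm_num
  · simp [hxy]

open Classical in
/-- Shearer's bound on the independence number, linearised at an arbitrary point `a`. -/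
theorem CliqueFree.exists_isIndepSet_subset {G : SimpleGraph V} (hG : G.CliqueFree 3)
    (W : Finset V) (a : ℝ) (ha : 0 < a) :
    ∃ I ⊆ W, G.IsIndepSet (I : Set V) ∧
      (shearerFun a + a * shearerSlope a) * W.card - shearerSlope a * ∑ v ∈ W, G.degreeIn W v
        ≤ I.card := by
  induction W using Finset.strongInduction generalizing a with
  | H W ih =>
  have hd0 : ∀ v, 0 ≤ G.degreeIn W v := fun v =>
    Finset.sum_nonneg fun u _ => by split_ifs <;> norm_num
  by_cases hE : ∑ v ∈ W, G.degreeIn W v = 0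
  · refine ⟨W, subset_rfl, ?_, ?_⟩
    · intro x hx y hy _ hxy
      have hx0 := (Finset.sum_eq_zero_iff_of_nonneg fun v _ => hd0 v).mp hE x hx
      have := (Finset.sum_eq_zero_iff_of_nonneg
        fun u _ => by split_ifs <;> norm_num).mp hx0 y hy
      simp [hxy] at this
    · rw [hE, mul_zero, sub_zero]
      exact mul_le_of_le_one_left (Nat.cast_nonneg _) (shearerFun_add_mul_slope_le_one ha)
  have hEpos : 0 < ∑ v ∈ W, G.degreeIn W v :=
    lt_of_le_of_ne (Finset.sum_nonneg fun v _ => hd0 v) (Ne.symm hE)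
  have hWne : W.Nonempty := by
    rw [Finset.nonempty_iff_ne_empty]; rintro rfl; simp at hE
  have hWpos : (0 : ℝ) < W.card := by exact_mod_cast hWne.card_pos
  set t : ℝ := (∑ v ∈ W, G.degreeIn W v) / W.card with ht
  have htpos : 0 < t := div_pos hEpos hWpos
  have htE : ∑ v ∈ W, G.degreeIn W v = t * W.card := by rw [ht]; field_simp
  set s : V → ℝ := fun v => ∑ u ∈ W, (if G.Adj v u then 1 else 0) * G.degreeIn W u with hs
  have hS : ∑ v ∈ W, s v = ∑ v ∈ W, G.degreeIn W v ^ 2 := by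
    rw [hs, Finset.sum_comm]
    refine Finset.sum_congr rfl fun u _ => ?_
    rw [← Finset.sum_mul, sq]
    congr 1
    simp only [degreeIn, G.adj_comm]
  have hS2 : t ^ 2 * W.card ≤ ∑ v ∈ W, s v := by
    rw [hS]
    have h := sq_sum_le_card_mul_sum_sq (s := W) (f := fun v => G.degreeIn W v)
    rw [htE] at h
    refine le_of_mul_le_mul_left ?_ hWpos
    linarith
  have hD := @shearerSlope_nonneg t
  -- Averaging over `v`: by Cauchy–Schwarz (`hS2`), the mean is at least the left side of Shearer's
  -- equation at `t`, which is zero.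
  obtain ⟨v, hv, hgood⟩ : ∃ v ∈ W, 0 ≤ 1 - (G.degreeIn W v + 1) * shearerFun t
      - (t + t * G.degreeIn W v - 2 * s v) * shearerSlope t := by
    apply Finset.exists_le_of_sum_le (f := fun _ => (0 : ℝ)) hWne
    have : ∑ v ∈ W, (1 - (G.degreeIn W v + 1) * shearerFun t
        - (t + t * G.degreeIn W v - 2 * s v) * shearerSlope t)
        = W.card - (∑ v ∈ W, G.degreeIn W v + W.card) * shearerFun t
        - (W.card * t + t * ∑ v ∈ W, G.degreeIn W v - 2 * ∑ v ∈ W, s v) * shearerSlope t := by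
      simp only [Finset.sum_sub_distrib, Finset.sum_add_distrib, ← Finset.sum_mul,
        ← Finset.mul_sum, Finset.sum_const, nsmul_eq_mul, mul_one]
    rw [this, htE, Finset.sum_const_zero]
    have hode := shearerFun_ode htpos
    nlinarith [mul_le_mul_of_nonneg_right hS2 hD, congrArg (fun z => (W.card : ℝ) * z) hode]
  set W' := W.filter fun u => u ≠ v ∧ ¬ G.Adj v u with hW'
  have hss : W' ⊂ W := by
    refine Finset.filter_ssubset.mpr ⟨v, hv, by simp⟩
  -- The hypothesis is used at the average degree `t` of `W`, not at `a`; the tangent inequality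
  -- `h3` returns to `a` at the end.
  obtain ⟨I, hIW, hI, hIcard⟩ := ih W' hss t htpos
  have hcard : (W'.card : ℝ) + 1 + G.degreeIn W v = W.card := by
    have h1 : G.degreeIn W v = ((W.filter fun u => G.Adj v u).card : ℝ) := by
      rw [degreeIn, Finset.sum_boole]
    have h2 : (W.filter fun u => ¬ (u ≠ v ∧ ¬ G.Adj v u)) =
        insert v (W.filter fun u => G.Adj v u) := by
      ext u
      simp only [Finset.mem_filter, Finset.mem_insert]
      constructor
      · rintro ⟨hu, h⟩
        by_cases huv : u = v
        · exact Or.inl huv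
        · exact Or.inr ⟨hu, by_contra fun h' => h ⟨huv, h'⟩⟩
      · rintro (rfl | ⟨hu, h⟩)
        · exact ⟨hv, fun h => h.1 rfl⟩
        · exact ⟨hu, fun h' => h'.2 h⟩
    have h3 := Finset.card_filter_add_card_filter_not (s := W) (fun u => u ≠ v ∧ ¬ G.Adj v u)
    rw [h2, Finset.card_insert_of_notMem (by simp)] at h3
    rw [h1, ← h3, hW']
    push_cast
    ring
  have hedge := sum_degreeIn_sdiff_le hG W v
  refine ⟨insert v I, ?_, ?_, ?_⟩
  · exact Finset.insert_subset hv (hIW.trans hss.subset)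
  · have hvI : ∀ u ∈ I, ¬ G.Adj v u := fun u hu => (Finset.mem_filter.mp (hIW hu)).2.2
    rw [Finset.coe_insert]
    intro x hx y hy hxy
    rcases hx with rfl | hx <;> rcases hy with rfl | hy
    · exact (hxy rfl).elim
    · exact hvI y hy
    · exact fun h => hvI x hx h.symm
    · exact hI hx hy hxy
  · have hvI : v ∉ I := fun h => (Finset.mem_filter.mp (hIW h)).2.1 rfl
    rw [Finset.card_insert_of_notMem hvI, htE]
    push_cast
    have hedge' : ∑ x ∈ W', G.degreeIn W' x ≤ t * W.card - 2 * s v := by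
      rw [← htE]; linarith
    have h1 := mul_le_mul_of_nonneg_left hedge' hD
    have h2 : (W'.card : ℝ) = W.card - 1 - G.degreeIn W v := by linarith
    rw [h2] at hIcard
    have h3 := mul_le_mul_of_nonneg_right (shearerFun_tangent_le ha htpos) hWpos.le
    nlinarith

end SimpleGraph

/-! ### Random vertex samples and the first lower bound. -/

/-- The probability that a random subset of `V`, containing each point independently with
probability `p`, equals `W`. -/
noncomputable def sampleWeight {V : Type*} [Fintype V] (p : ℝ) (W : Finset V) : ℝ :=
  p ^ W.card * (1 - p) ^ (Fintype.card V - W.card)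

open Classical in
theorem sum_sampleWeight_superset {V : Type*} [Fintype V] (p : ℝ) (I : Finset V) :
    ∑ W : Finset V, (if I ⊆ W then sampleWeight p W else 0) = p ^ I.card := by
  -- Points of `I` may not be omitted, so their factor `1 - p` is replaced by `0`.
  have h := Finset.prod_add (fun _ : V => p) (fun i => if i ∈ I then 0 else 1 - p) Finset.univ
  have hl : ∏ i : V, (p + if i ∈ I then 0 else 1 - p) = p ^ I.card := by
    have : ∀ i : V, (p + if i ∈ I then 0 else 1 - p) = if i ∈ I then p else 1 := fun i => by
      split_ifs <;> ring
    simp only [this, Finset.prod_ite_mem, Finset.univ_inter, Finset.prod_const]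
  rw [hl, Finset.powerset_univ] at h
  rw [h]
  refine Finset.sum_congr rfl fun W _ => ?_
  rw [Finset.prod_const]
  split_ifs with hIW
  · have : ∀ i ∈ Finset.univ \ W, (if i ∈ I then 0 else 1 - p) = 1 - p := fun i hi =>
      if_neg fun hiI => (Finset.mem_sdiff.mp hi).2 (hIW hiI)
    rw [Finset.prod_congr rfl this, Finset.prod_const, sampleWeight,
      Finset.card_sdiff_of_subset (Finset.subset_univ W), Finset.card_univ]
  · obtain ⟨i, hiI, hiW⟩ := Finset.not_subset.mp hIW
    rw [Finset.prod_eq_zero (i := i) (by simp [hiW]) (by simp [hiI]), mul_zero]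

theorem sum_sampleWeight {V : Type*} [Fintype V] (p : ℝ) :
    ∑ W : Finset V, sampleWeight p W = 1 := by
  classical
  simpa using sum_sampleWeight_superset (V := V) p ∅

theorem sum_sampleWeight_mul_card {V : Type*} [Fintype V] (p : ℝ) :
    ∑ W : Finset V, sampleWeight p W * W.card = p * Fintype.card V := by
  classical
  have h : ∀ W : Finset V, sampleWeight p W * W.card =
      ∑ v : V, if {v} ⊆ W then sampleWeight p W else 0 := fun W => by
    simp [Finset.sum_ite_mem, mul_comm]
  simp only [h]
  rw [Finset.sum_comm]
  simp only [sum_sampleWeight_superset]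
  simp [mul_comm]

namespace SimpleGraph

variable {V : Type*} [Fintype V]

open Classical in
theorem sum_sampleWeight_mul_sum_degreeIn (G : SimpleGraph V) (p : ℝ) :
    ∑ W : Finset V, sampleWeight p W * ∑ v ∈ W, G.degreeIn W v
      = p ^ 2 * ∑ v, (G.degree v : ℝ) := by
  have h : ∀ W : Finset V, sampleWeight p W * ∑ v ∈ W, G.degreeIn W v =
      ∑ v : V, ∑ u : V, if G.Adj v u then (if {v, u} ⊆ W then sampleWeight p W else 0) else 0 := by
    intro W
    rw [Finset.mul_sum, ← Finset.sum_subset (Finset.subset_univ W)]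
    · refine Finset.sum_congr rfl fun v hv => ?_
      rw [degreeIn, Finset.mul_sum, ← Finset.sum_subset (Finset.subset_univ W)]
      · refine Finset.sum_congr rfl fun u hu => ?_
        simp [Finset.insert_subset_iff, hv, hu]
      · intro u _ hu
        simp [Finset.insert_subset_iff, hu]
    · intro v _ hv
      simp [Finset.insert_subset_iff, hv]
  simp only [h]
  rw [Finset.sum_comm, Finset.mul_sum]
  refine Finset.sum_congr rfl fun v _ => ?_
  rw [Finset.sum_comm]
  have h2 : ∀ u : V, ∑ W : Finset V,
      (if G.Adj v u then (if {v, u} ⊆ W then sampleWeight p W else 0) else 0) =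
      p ^ 2 * if G.Adj v u then 1 else 0 := by
    intro u
    split_ifs with hvu
    · rw [sum_sampleWeight_superset, Finset.card_pair hvu.ne, mul_one]
    · simp
  simp only [h2]
  rw [← Finset.mul_sum, Finset.sum_boole, ← G.card_neighborFinset_eq_degree,
    G.neighborFinset_eq_filter]

open Classical in
theorem numIndepSets_eq_sum (G : SimpleGraph V) {p : ℝ} (hp : 0 < p) :
    (G.numIndepSets : ℝ) = ∑ W : Finset V, sampleWeight p W *
      ∑ I : Finset V, if G.IsIndepSet (I : Set V) ∧ I ⊆ W then (p ^ I.card)⁻¹ else 0 := by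
  simp only [Finset.mul_sum]
  rw [Finset.sum_comm, numIndepSets, Finset.card_filter]
  push_cast
  refine Finset.sum_congr rfl fun I _ => ?_
  have : ∀ W : Finset V, sampleWeight p W *
      (if G.IsIndepSet (I : Set V) ∧ I ⊆ W then (p ^ I.card)⁻¹ else 0) =
      (if G.IsIndepSet (I : Set V) then (p ^ I.card)⁻¹ else 0) *
        if I ⊆ W then sampleWeight p W else 0 := fun W => by
    by_cases h1 : G.IsIndepSet (I : Set V) <;> by_cases h2 : I ⊆ W <;> simp [h1, h2, mul_comm]
  simp only [this]
  rw [← Finset.mul_sum, sum_sampleWeight_superset]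
  split_ifs
  · rw [inv_mul_cancel₀ (pow_ne_zero _ hp.ne')]
  · simp

/-- Sampling the vertices with probability `p` and applying Shearer's bound to the sample. -/
theorem CliqueFree.exp_le_numIndepSets {G : SimpleGraph V} (hG : G.CliqueFree 3) {p a : ℝ}
    (hp : 0 < p) (hp1 : p ≤ 1) (ha : 0 < a) :
    Real.exp (-Real.log p * ((shearerFun a + a * shearerSlope a) * (p * Fintype.card V)
      - shearerSlope a * (p ^ 2 * (Fintype.card V * G.avgDegree)))) ≤ G.numIndepSets := by
  classical
  have hw : ∀ W : Finset V, 0 ≤ sampleWeight p W := fun W =>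
    mul_nonneg (pow_nonneg hp.le _) (pow_nonneg (by linarith) _)
  have hlog : 0 ≤ -Real.log p := by linarith [Real.log_nonpos hp.le hp1]
  have hdeg : (Fintype.card V : ℝ) * G.avgDegree = ∑ v, (G.degree v : ℝ) := by
    rw [avgDegree]
    rcases isEmpty_or_nonempty V with h | h
    · simp
    · rw [mul_div_cancel₀ _ (by positivity)]
  set c := -Real.log p
  set A := shearerFun a + a * shearerSlope a
  set D := shearerSlope a
  set g : Finset V → ℝ := fun W => c * (A * W.card - D * ∑ v ∈ W, G.degreeIn W v) with hg
  have hmean : ∑ W : Finset V, sampleWeight p W • g W =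
      c * (A * (p * Fintype.card V) - D * (p ^ 2 * (Fintype.card V * G.avgDegree))) := by
    rw [hdeg, ← sum_sampleWeight_mul_card, ← sum_sampleWeight_mul_sum_degreeIn, Finset.mul_sum,
      Finset.mul_sum, ← Finset.sum_sub_distrib, Finset.mul_sum]
    refine Finset.sum_congr rfl fun W _ => ?_
    rw [hg, smul_eq_mul]
    ring
  rw [← hmean, G.numIndepSets_eq_sum hp]
  refine (convexOn_exp.map_sum_le (fun W _ => hw W) (sum_sampleWeight p)
    fun _ _ => Set.mem_univ _).trans (Finset.sum_le_sum fun W _ => ?_)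
  refine mul_le_mul_of_nonneg_left ?_ (hw W)
  obtain ⟨I, hIW, hI, hcard⟩ := hG.exists_isIndepSet_subset W a ha
  calc Real.exp (g W) ≤ Real.exp (c * I.card) :=
        Real.exp_le_exp.mpr (mul_le_mul_of_nonneg_left hcard hlog)
    _ = (p ^ I.card)⁻¹ := by
        rw [mul_comm, Real.exp_nat_mul, Real.exp_neg, Real.exp_log hp, inv_pow]
    _ = if G.IsIndepSet (I : Set V) ∧ I ⊆ W then (p ^ I.card)⁻¹ else 0 := by rw [if_pos ⟨hI, hIW⟩]
    -- Only the one set given by Shearer's bound is kept.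
    _ ≤ _ := Finset.single_le_sum
        (f := fun I : Finset V =>
          if G.IsIndepSet (I : Set V) ∧ I ⊆ W then (p ^ I.card)⁻¹ else 0)
        (fun J _ => by split_ifs <;> positivity) (Finset.mem_univ I)

/-- To leading order the exponent is `(n / T) * log (1 / p) * log (p * T)`, largest at `p = 1 / √T`;
the tangent point is then `p * T = √T`. Allowing any `T` above the average degree avoids proving
monotonicity later. -/
theorem CliqueFree.exp_log_mul_log_le_numIndepSets {G : SimpleGraph V} (hG : G.CliqueFree 3)
    {T : ℝ} (hT : 1 ≤ T) (ht : G.avgDegree ≤ T) :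
    Real.exp (1 / 2 * (Fintype.card V / T) * Real.log T * (1 / 2 * Real.log T - 1))
      ≤ G.numIndepSets := by
  have hT0 : 0 < T := by linarith
  set a := √T with ha
  have ha1 : 1 ≤ a := Real.one_le_sqrt.mpr hT
  have ha0 : 0 < a := by linarith
  have haT : a ^ 2 = T := Real.sq_sqrt hT0.le
  have hlog : Real.log T = 2 * Real.log a := by rw [← haT, Real.log_pow]; norm_num
  have hloga : 0 ≤ Real.log a := Real.log_nonneg ha1
  refine le_trans (Real.exp_le_exp.mpr ?_)
    (hG.exp_le_numIndepSets (p := a⁻¹) (inv_pos.mpr ha0) (inv_le_one_of_one_le₀ ha1) ha0)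
  rw [Real.log_inv, neg_neg, hlog, ← haT]
  have hn : (0 : ℝ) ≤ Fintype.card V := Nat.cast_nonneg _
  have h1 : shearerSlope a * (a⁻¹ ^ 2 * (Fintype.card V * G.avgDegree))
      ≤ shearerSlope a * Fintype.card V := by
    refine mul_le_mul_of_nonneg_left ?_ shearerSlope_nonneg
    rw [inv_pow, haT, inv_mul_le_iff₀ hT0, mul_comm T]
    exact mul_le_mul_of_nonneg_left ht hn
  have h2 := mul_le_mul_of_nonneg_right (log_sub_one_div_le_shearerFun ha1)
    (mul_nonneg (inv_pos.mpr ha0).le hn)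
  have h3 : 1 / 2 * (Fintype.card V / a ^ 2) * (2 * Real.log a) * (1 / 2 * (2 * Real.log a) - 1)
      = Real.log a * ((Real.log a - 1) / a * (a⁻¹ * Fintype.card V)) := by
    field_simp
  rw [h3]
  refine mul_le_mul_of_nonneg_left ?_ hloga
  have h4 : a * shearerSlope a * (a⁻¹ * Fintype.card V) = shearerSlope a * Fintype.card V := by
    field_simp
  linarith

theorem one_le_numIndepSets (G : SimpleGraph V) : 1 ≤ G.numIndepSets := by
  classical
  exact Finset.card_pos.mpr ⟨∅, by simp⟩

theorem CliqueFree.two_rpow_le_numIndepSets {G : SimpleGraph V} (hG : G.CliqueFree 3) :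
    (2 : ℝ) ^ G.avgDegree ≤ G.numIndepSets := by
  classical
  rcases isEmpty_or_nonempty V with h | h
  · simpa [avgDegree] using G.one_le_numIndepSets
  obtain ⟨v, -, hv⟩ : ∃ v ∈ (Finset.univ : Finset V), G.avgDegree ≤ (G.degree v : ℝ) := by
    apply Finset.exists_le_of_sum_le Finset.univ_nonempty
    rw [Finset.sum_const, nsmul_eq_mul, Finset.card_univ, avgDegree,
      mul_div_cancel₀ _ (by positivity)]
  calc (2 : ℝ) ^ G.avgDegree ≤ (2 : ℝ) ^ (G.degree v : ℝ) :=
        Real.rpow_le_rpow_of_exponent_le one_le_two hv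
    _ = ((G.neighborFinset v).powerset.card : ℕ) := by
        rw [Real.rpow_natCast, Finset.card_powerset, G.card_neighborFinset_eq_degree]
        push_cast
        rfl
    _ ≤ G.numIndepSets := by
        rw [numIndepSets]
        refine Nat.cast_le.mpr (Finset.card_le_card fun s hs => ?_)
        simp only [Finset.mem_filter, Finset.mem_univ, true_and]
        refine (G.isIndepSet_neighborSet_of_triangleFree hG v).mono ?_
        intro x hx
        simpa using Finset.mem_powerset.mp hs hx

end SimpleGraph

/-! ### Balancing the two bounds. -/

section Asymptotics

open Filter Topology

/-- The average degree at which the two lower bounds balance. -/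
noncomputable def balancedDegree (n : ℕ) : ℝ := √(n / Real.log 2) * Real.log n / 4

theorem tendsto_sqrt_div_log_two : Tendsto (fun n : ℕ => √(n / Real.log 2)) atTop atTop :=
  Real.tendsto_sqrt_atTop.comp
    (tendsto_natCast_atTop_atTop.atTop_div_const (Real.log_pos one_lt_two))

theorem tendsto_log_natCast : Tendsto (fun n : ℕ => Real.log n) atTop atTop :=
  Real.tendsto_log_atTop.comp tendsto_natCast_atTop_atTop

theorem tendsto_balancedDegree : Tendsto balancedDegree atTop atTop :=
  (tendsto_sqrt_div_log_two.atTop_mul_atTop₀ tendsto_log_natCast).atTop_div_const (by norm_num)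

/-- The logarithm of the balanced degree is `log n / 2 + log (log n)` up to a constant. -/
theorem tendsto_log_balancedDegree_div_log :
    Tendsto (fun n : ℕ => Real.log (balancedDegree n) / Real.log n) atTop (𝓝 (1 / 2)) := by
  have h1 : Tendsto (fun n : ℕ => Real.log (Real.log n) / Real.log n) atTop (𝓝 0) :=
    (Real.isLittleO_log_id_atTop.tendsto_div_nhds_zero).comp tendsto_log_natCast
  have h2 : Tendsto (fun n : ℕ => (Real.log (Real.log 2) / 2 + Real.log 4) / Real.log n)
      atTop (𝓝 0) := tendsto_const_nhds.div_atTop tendsto_log_natCast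
  have h := (h1.const_add (1 / 2)).sub h2
  rw [add_zero, sub_zero] at h
  refine h.congr' ?_
  filter_upwards [eventually_gt_atTop 1] with n hn
  have hn0 : (0 : ℝ) < n := by positivity
  have hl : 0 < Real.log n := Real.log_pos (by exact_mod_cast hn)
  have hl2 : 0 < Real.log 2 := Real.log_pos one_lt_two
  rw [balancedDegree, Real.log_div (by positivity) (by norm_num),
    Real.log_mul (by positivity) (by positivity), Real.log_sqrt (by positivity),
    Real.log_div (by positivity) (by positivity)]
  field_simp
  ring

/-- The ratio of the logarithms of the two lower bounds at the balanced degree. -/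
noncomputable def balancedRatio (n : ℕ) : ℝ :=
  4 * (Real.log (balancedDegree n) / Real.log n) *
    (Real.log (balancedDegree n) / Real.log n - 2 / Real.log n)

theorem tendsto_balancedRatio : Tendsto balancedRatio atTop (𝓝 1) := by
  have h := (tendsto_log_balancedDegree_div_log.const_mul 4).mul
    (tendsto_log_balancedDegree_div_log.sub
      ((tendsto_const_nhds (x := (2 : ℝ))).div_atTop tendsto_log_natCast))
  rwa [show (4 : ℝ) * (1 / 2) * (1 / 2 - 0) = 1 by norm_num] at h

theorem balancedDegree_mul_log_two (n : ℕ) :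
    balancedDegree n * Real.log 2 = √(n * Real.log 2) * Real.log n / 4 := by
  have hl2 : 0 < Real.log 2 := Real.log_pos one_lt_two
  have h : √(n / Real.log 2) * Real.log 2 = √(n * Real.log 2) := by
    rw [← Real.sqrt_sq hl2.le, ← Real.sqrt_mul (by positivity), Real.sqrt_sq hl2.le]
    congr 1
    field_simp
  rw [← h, balancedDegree]
  ring

theorem balancedRatio_mul {n : ℕ} (hT : 1 ≤ balancedDegree n) :
    balancedRatio n * (√(n * Real.log 2) * Real.log n / 4) =
      1 / 2 * (n / balancedDegree n) * Real.log (balancedDegree n) *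
        (1 / 2 * Real.log (balancedDegree n) - 1) := by
  have hl2 : 0 < Real.log 2 := Real.log_pos one_lt_two
  have hl : Real.log n ≠ 0 := fun h => by
    rw [balancedDegree, h] at hT; norm_num at hT
  have hsq : balancedDegree n ^ 2 * Real.log 2 * 16 = n * Real.log n ^ 2 := by
    rw [balancedDegree, div_pow, mul_pow, Real.sq_sqrt (by positivity)]
    field_simp
    norm_num
  rw [← balancedDegree_mul_log_two, balancedRatio]
  generalize balancedDegree n = T at *
  have hT0 : T ≠ 0 := by positivity
  field_simp
  linear_combination (Real.log T * (Real.log T - 2)) * hsq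

end Asymptotics

theorem mainTheorem2 :
    (∀ (V : Type*) [Fintype V] (G : SimpleGraph V), G.CliqueFree 3 →
      ∀ (n : ℕ) (t : ℝ), n = Fintype.card V → t = G.avgDegree →
        (1 ≤ t →
          max
            (Real.exp ((1 - (n : ℝ) ^ (-(1 / 12 : ℝ))) * (1 / 2) * ((n : ℝ) / t) * Real.log t *
              ((1 / 2) * Real.log t - 1)))
            ((2 : ℝ) ^ t)
          ≤ (G.numIndepSets : ℝ)) ∧
        (2 : ℝ) ^ t ≤ (G.numIndepSets : ℝ)) ∧
    (∃ ε : ℕ → ℝ, Filter.Tendsto ε Filter.atTop (nhds 0) ∧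
      ∀ (V : Type*) [Fintype V] (H : SimpleGraph V), H.CliqueFree 3 →
        ∀ n : ℕ, n = Fintype.card V →
          Real.exp ((1 - ε n) * (Real.sqrt ((n : ℝ) * Real.log 2) * Real.log (n : ℝ) / 4))
            ≤ (H.numIndepSets : ℝ)) := by
  refine ⟨?_, ?_⟩
  · rintro V _ G hG n t hn rfl
    refine ⟨fun ht => max_le ?_ hG.two_rpow_le_numIndepSets, hG.two_rpow_le_numIndepSets⟩
    have hone : (1 : ℝ) ≤ G.numIndepSets := by exact_mod_cast G.one_le_numIndepSets
    set E := 1 / 2 * ((n : ℝ) / G.avgDegree) * Real.log G.avgDegree *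
      (1 / 2 * Real.log G.avgDegree - 1) with hE
    have hmain : Real.exp E ≤ G.numIndepSets := by
      rw [hE, hn]; exact hG.exp_log_mul_log_le_numIndepSets ht le_rfl
    have hr0 : 0 ≤ (n : ℝ) ^ (-(1 / 12 : ℝ)) := by positivity
    have hr1 : (n : ℝ) ^ (-(1 / 12 : ℝ)) ≤ 1 := by
      rcases Nat.eq_zero_or_pos n with h | h
      · rw [h, Nat.cast_zero, Real.zero_rpow (by norm_num)]; exact zero_le_one
      · exact Real.rpow_le_one_of_one_le_of_nonpos (by exact_mod_cast h) (by norm_num)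
    have heq : (1 - (n : ℝ) ^ (-(1 / 12 : ℝ))) * (1 / 2) * ((n : ℝ) / G.avgDegree) *
        Real.log G.avgDegree * (1 / 2 * Real.log G.avgDegree - 1) =
        (1 - (n : ℝ) ^ (-(1 / 12 : ℝ))) * E := by rw [hE]; ring
    rw [heq]
    -- The factor in `[0, 1]` only weakens the bound when `E ≥ 0`; otherwise the exponential is at
    -- most `1`.
    rcases le_total 0 E with h0 | h0
    · exact (Real.exp_le_exp.mpr (mul_le_of_le_one_left h0 (by linarith))).trans hmain
    · refine le_trans (Real.exp_le_one_iff.mpr ?_) hone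
      exact mul_nonpos_of_nonneg_of_nonpos (by linarith) h0
  · refine ⟨fun n => if 1 ≤ balancedDegree n then max 0 (1 - balancedRatio n) else 1, ?_, ?_⟩
    · have h := (tendsto_const_nhds (x := (0 : ℝ))).max (tendsto_balancedRatio.const_sub 1)
      rw [sub_self, max_self] at h
      refine h.congr' ?_
      filter_upwards [tendsto_balancedDegree.eventually_ge_atTop 1] with n hn
      rw [if_pos hn]
    · intro V _ H hH n hn
      have hone : (1 : ℝ) ≤ H.numIndepSets := by exact_mod_cast H.one_le_numIndepSets
      by_cases hT : 1 ≤ balancedDegree n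
      · simp only [if_pos hT]
        have hS : 0 ≤ √(n * Real.log 2) * Real.log n / 4 := by
          have := Real.log_natCast_nonneg n
          positivity
        rcases le_total H.avgDegree (balancedDegree n) with h | h
        · refine le_trans (Real.exp_le_exp.mpr ?_) (hH.exp_log_mul_log_le_numIndepSets hT h)
          rw [← hn, ← balancedRatio_mul hT]
          refine mul_le_mul_of_nonneg_right ?_ hS
          linarith [le_max_right 0 (1 - balancedRatio n)]
        · refine le_trans ?_ hH.two_rpow_le_numIndepSets
          rw [Real.rpow_def_of_pos two_pos]
          refine Real.exp_le_exp.mpr ?_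
          calc _ ≤ √(n * Real.log 2) * Real.log n / 4 :=
                mul_le_of_le_one_left hS (by linarith [le_max_left 0 (1 - balancedRatio n)])
            _ = Real.log 2 * balancedDegree n := by rw [← balancedDegree_mul_log_two, mul_comm]
            _ ≤ _ := mul_le_mul_of_nonneg_left h (Real.log_nonneg one_le_two)
      · simpa only [if_neg hT, sub_self, zero_mul, Real.exp_zero] using hone
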